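/- Let $G$ be a group acting on the left on a non-empty set $M$ transitively, the action being written $(g,m)\mapsto g\cdot m$. Fix a point $m_0\in M$ and, for each $m\in M$, an element $g_{m_0,m}\in G$ with $g_{m_0,m}\cdot m_0=m$; these data form a cell space $\mathcal R$. Let $G_0$ be the stabiliser of $m_0$, let $G/G_0$ be the set of left cosets, and for $m\in M$ and $gG_0\in G/G_0$ put $$m\lhd gG_0 = g_{m_0,m}\,g\,g_{m_0,m}^{-1}\cdot m = g_{m_0,m}\,g\cdot m_0 .$$ For $\mathfrak g\in G/G_0$ write $(\_\lhd\mathfrak g)$ for the map $M\to M$, $m\mapsto m\lhd\mathfrak g$. The cell space $\mathcal R$ is called right amenable if there is a finitely additive probability measure $\mu$ on the power set of $M$ such that, for each $\mathfrak g\in G/G_0$ and each $A\subseteq M$ on which $(\_\lhd\mathfrak g)$ is injective, $\mu(A\lhd\mathfrak g)=\mu(A)$. For $S\subseteq G/G_0$ put $S^{-1}=\{g^{-1}G_0 : s\in S,\ g\in s\}$. The set $S$ is called symmetric if $S^{-1}\subseteq S$, and it is called a right generating set of $\mathcal R$ if $G_0\cdot S\subseteq S$ and, for each $m\in M$, there are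 $k\in\mathbb N_0$ and $s_1,\dots,s_k\in S\cup S^{-1}$ such that $(((m_0\lhd s_1)\lhd s_2)\lhd\cdots)\lhd s_k=m$. The $S$-isoperimetric constant of $\mathcal R$ is $$\iota_S(\mathcal R)=\inf_{F}\ \frac{\bigl|\bigcup_{s\in S}F\setminus(\_\lhd s)^{-1}(F)\bigr|}{|F|},$$ where $F$ ranges over all non-empty finite subsets of $M$. Assume that $G_0$ is finite, and let $S$ be a finite and symmetric right generating set of $\mathcal R$. Then the following statements are equivalent: 1. The cell space $\mathcal R$ is right amenable. 2. For each real number $\varepsilon>0$ there is a non-empty finite subset $F$ of $M$ such that, for each $s\in S$, $\dfrac{|F\setminus(\_\lhd s)^{-1}(F)|}{|F|}<\varepsilon$. 3. $\iota_S(\mathcal R)=0$. -/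

import Mathlib

/-- A cell space whose underlying left group set is the given action of `G` on `M`: an origin `m₀`
together with a family `(g_{m₀,m})` of elements of `G` such that `g_{m₀,m} • m₀ = m`. The action is
then automatically transitive (and `M` non-empty), see `CellSpace.isPretransitive`. -/
structure CellSpace (M : Type*) (G : Type*) [Group G] [MulAction G M] where
  /-- the origin `m₀` -/
  origin : M
  /-- the coordinates `m ↦ g_{m₀,m}` -/
  coord : M → G
  coord_smul_origin : ∀ m : M, coord m • origin = m

namespace CellSpace

variable {M : Type*} {G : Type*} [Group G] [MulAction G M]

theorem isPretransitive (R : CellSpace M G) : MulAction.IsPretransitive G M :=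
  ⟨fun x y => ⟨R.coord y * (R.coord x)⁻¹, by
    have hx : (R.coord x)⁻¹ • x = R.origin := by
      rw [inv_smul_eq_iff, R.coord_smul_origin]
    rw [mul_smul, hx, R.coord_smul_origin]⟩⟩

/-- The stabiliser `G₀` of the origin. -/
abbrev stab (R : CellSpace M G) : Subgroup G := MulAction.stabilizer G R.origin

/-- The set `G ⧸ G₀` of left cosets `g G₀`. -/
abbrev Coset (R : CellSpace M G) : Type _ := G ⧸ R.stab

/-- The right quotient set semi-action `m ⊲ gG₀ = g_{m₀,m} g • m₀`, which is also
`(g_{m₀,m} g g_{m₀,m}⁻¹) • m` by `semiAct_mk'` below. -/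
def semiAct (R : CellSpace M G) (m : M) (q : R.Coset) : M :=
  R.coord m • MulAction.ofQuotientStabilizer G R.origin q

theorem semiAct_mk (R : CellSpace M G) (m : M) (g : G) :
    R.semiAct m (g : R.Coset) = (R.coord m * g) • R.origin := by
  rw [semiAct, MulAction.ofQuotientStabilizer_mk, mul_smul]

theorem semiAct_mk' (R : CellSpace M G) (m : M) (g : G) :
    R.semiAct m (g : R.Coset) = (R.coord m * g * (R.coord m)⁻¹) • m := by
  have h : (R.coord m)⁻¹ • m = R.origin := by
    rw [inv_smul_eq_iff, R.coord_smul_origin]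
  rw [semiAct_mk, mul_smul (R.coord m * g), h]

/-- `S⁻¹ = {g⁻¹ G₀ | s ∈ S, g ∈ s}` -/
def invSet (R : CellSpace M G) (S : Set R.Coset) : Set R.Coset :=
  {q | ∃ g : G, (g : R.Coset) ∈ S ∧ q = ((g⁻¹ : G) : R.Coset)}

/-- `S` is a right generating set: `G₀ · S ⊆ S`, and every `m` is of the form
`(((m₀ ⊲ s₁) ⊲ s₂) ⊲ ⋯) ⊲ s_k` with `k ≥ 0` and `s_i ∈ S ∪ S⁻¹`. -/
structure IsRightGenerating (R : CellSpace M G) (S : Set R.Coset) : Prop where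
  stab_smul_mem : ∀ g₀ ∈ R.stab, ∀ s ∈ S, g₀ • s ∈ S
  exists_word : ∀ m : M, ∃ l : List R.Coset,
    (∀ s ∈ l, s ∈ S ∪ R.invSet S) ∧ l.foldl R.semiAct R.origin = m

/-- `S` is symmetric: `S⁻¹ ⊆ S`. -/
def IsSymmetric (R : CellSpace M G) (S : Set R.Coset) : Prop :=
  R.invSet S ⊆ S

end CellSpace

/-- `μ` is a finitely additive probability measure on the power set of `M`. -/
structure IsFinAddProbMeasure {M : Type*} (μ : Set M → ℝ) : Prop where
  nonneg : ∀ A : Set M, 0 ≤ μ A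
  univ_eq_one : μ Set.univ = 1
  union_eq_add : ∀ A B : Set M, Disjoint A B → μ (A ∪ B) = μ A + μ B

namespace CellSpace

variable {M : Type*} {G : Type*} [Group G] [MulAction G M]

/-- Right amenability: there is a finitely additive probability measure on `M` that is
semi-invariant under the right semi-action. -/
def RightAmenable (R : CellSpace M G) : Prop :=
  ∃ μ : Set M → ℝ, IsFinAddProbMeasure μ ∧
    ∀ (q : R.Coset) (A : Set M), Set.InjOn (fun m => R.semiAct m q) A →
      μ ((fun m => R.semiAct m q) '' A) = μ A

/-- `F \ (· ⊲ q)⁻¹(F)` -/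
def leaving (R : CellSpace M G) (F : Set M) (q : R.Coset) : Set M :=
  F \ ((fun m => R.semiAct m q) ⁻¹' F)

/-- The `E`-isoperimetric constant: the infimum over all non-empty finite `F ⊆ M` of
`|⋃_{e ∈ E} F \ (· ⊲ e)⁻¹(F)| / |F|`. -/
noncomputable def isoperimetricConstant (R : CellSpace M G) (E : Set R.Coset) : ℝ :=
  ⨅ F : {F : Finset M // F.Nonempty},
    ((⋃ e ∈ E, R.leaving (F.1 : Set M) e).ncard : ℝ) / (F.1.card : ℝ)

end CellSpace

/-! ### Composition and reversal of steps up to the stabiliser -/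

namespace CellSpace

variable {M : Type*} {G : Type*} [Group G] [MulAction G M]

/-! The semi-action fails to be an action only by a twist in `G₀`. As `S` is `G₀`-stable and `G₀` is
finite, the twist costs at most a factor `|G₀|`.

Small boundaries give amenability: every coset is reached by a word in `S`, so the part of `F`
leaving along it is at most a constant times the `S`-boundary (`exists_ncard_leaving_le`). Hence `A
∩ F` and `(A ⊲ q) ∩ F` differ in size by `O(|∂F|)`, and an ultrafilter limit of counting measures on
sets with `|∂F|/|F| → 0` is semi-invariant.

Amenability gives small boundaries: otherwise every finite set grows by a fixed factor `1 + δ` under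
`S ∪ {G₀}`. Iteration makes the factor at least 2, Hall's theorem then embeds two copies of `M` into
`M` by finitely many cosets, and a semi-invariant measure would give mass 2 inside mass 1
(`RightAmenable.not_injective`).

Statements 2 and 3 differ by a union bound over the finite set `S`. -/

theorem exists_semiAct_smul (R : CellSpace M G) (m : M) (g : G) :
    ∃ h ∈ R.stab, ∀ s : R.Coset,
      R.semiAct m (g • s) = R.semiAct (R.semiAct m (g : R.Coset)) (h • s) := by
  -- Both the coordinate of `m ⊲ gG₀` and `g_{m₀,m} g` carry the origin to `m ⊲ gG₀`, so they differ
  -- by an element of the stabiliser.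
  refine ⟨(R.coord (R.semiAct m (g : R.Coset)))⁻¹ * (R.coord m * g), ?_, ?_⟩
  · rw [MulAction.mem_stabilizer_iff, mul_smul, inv_smul_eq_iff, R.coord_smul_origin, semiAct_mk]
  · intro s
    induction s using QuotientGroup.induction_on with
    | H x =>
      rw [MulAction.Quotient.smul_coe, MulAction.Quotient.smul_coe, semiAct_mk, semiAct_mk]
      simp only [smul_eq_mul]
      congr 1
      group

/-- Two successive steps are one step whose coset depends on the start only through an element
of the stabiliser. -/
theorem exists_semiAct_semiAct (R : CellSpace M G) (m : M) (g : G) (s : R.Coset) :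
    ∃ h ∈ R.stab,
      R.semiAct (R.semiAct m (g : R.Coset)) s = R.semiAct m (g • h • s) := by
  obtain ⟨h, hh, H⟩ := R.exists_semiAct_smul m g
  refine ⟨h⁻¹, inv_mem hh, ?_⟩
  rw [H, smul_inv_smul]

theorem semiAct_one (R : CellSpace M G) (m : M) : R.semiAct m ((1 : G) : R.Coset) = m := by
  rw [semiAct_mk, mul_one, R.coord_smul_origin]

theorem smul_one_coset (R : CellSpace M G) {h : G} (hh : h ∈ R.stab) :
    h • ((1 : G) : R.Coset) = ((1 : G) : R.Coset) := by
  rw [MulAction.Quotient.smul_coe, smul_eq_mul, mul_one, QuotientGroup.eq]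
  simpa using hh

/-- The cosets `h g⁻¹ G₀`, `h ∈ G₀`, by which a step along `g G₀` can be reversed. -/
def reverseCosets (R : CellSpace M G) (g : G) : Set R.Coset :=
  Set.range fun h : R.stab => (((h : G) * g⁻¹ : G) : R.Coset)

theorem finite_reverseCosets (R : CellSpace M G) [Finite R.stab] (g : G) :
    (R.reverseCosets g).Finite :=
  Set.finite_range _

theorem ncard_reverseCosets_le (R : CellSpace M G) [Finite R.stab] (g : G) :
    (R.reverseCosets g).ncard ≤ Nat.card R.stab := by
  rw [reverseCosets, ← Set.image_univ, ← Set.ncard_univ]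
  exact Set.ncard_image_le

/-- Steps need not be injective, but the reversing coset depends on the start only through an
element of `G₀`. Finiteness of `G₀` thus bounds the fibres of a step. -/
theorem exists_reverse (R : CellSpace M G) (m : M) (g : G) :
    ∃ q ∈ R.reverseCosets g, R.semiAct (R.semiAct m (g : R.Coset)) q = m := by
  have hh : (R.coord (R.semiAct m (g : R.Coset)))⁻¹ * (R.coord m * g) ∈ R.stab := by
    rw [MulAction.mem_stabilizer_iff, mul_smul, inv_smul_eq_iff, R.coord_smul_origin, semiAct_mk]
  refine ⟨_, ⟨⟨_, hh⟩, rfl⟩, ?_⟩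
  rw [semiAct_mk]
  conv_rhs => rw [← R.coord_smul_origin m]
  congr 1
  group

theorem ncard_image2_semiAct_le (R : CellSpace M G) {T : Set M} (hT : T.Finite)
    {Q : Set R.Coset} (hQ : Q.Finite) :
    (Set.image2 R.semiAct T Q).ncard ≤ T.ncard * Q.ncard := by
  rw [← Set.image_uncurry_prod, ← Set.ncard_prod]
  exact Set.ncard_image_le (hT.prod hQ)

theorem preimage_semiAct_subset (R : CellSpace M G) (g : G) (T : Set M) :
    (fun m => R.semiAct m (g : R.Coset)) ⁻¹' T ⊆ Set.image2 R.semiAct T (R.reverseCosets g) := by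
  intro m hm
  obtain ⟨q, hq, h⟩ := R.exists_reverse m g
  exact ⟨_, hm, q, hq, h⟩

theorem finite_preimage_semiAct (R : CellSpace M G) [Finite R.stab] (g : G) {T : Set M}
    (hT : T.Finite) : ((fun m => R.semiAct m (g : R.Coset)) ⁻¹' T).Finite :=
  (hT.image2 _ (R.finite_reverseCosets g)).subset (R.preimage_semiAct_subset g T)

theorem ncard_preimage_semiAct_le (R : CellSpace M G) [Finite R.stab] (g : G) {T : Set M}
    (hT : T.Finite) :
    ((fun m => R.semiAct m (g : R.Coset)) ⁻¹' T).ncard ≤ T.ncard * Nat.card R.stab :=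
  (Set.ncard_le_ncard (R.preimage_semiAct_subset g T)
    (hT.image2 _ (R.finite_reverseCosets g))).trans <|
    (R.ncard_image2_semiAct_le hT (R.finite_reverseCosets g)).trans <|
      Nat.mul_le_mul_left _ (R.ncard_reverseCosets_le g)

/-- The points of `F` from which some step along `Q` leaves `F`. -/
def boundary (R : CellSpace M G) (Q : Set R.Coset) (F : Set M) : Set M :=
  ⋃ q ∈ Q, R.leaving F q

/-! ### Control of every coset by the boundary along the generators -/

theorem leaving_subset_boundary (R : CellSpace M G) {Q : Set R.Coset} (F : Set M) {q : R.Coset}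
    (hq : q ∈ Q) : R.leaving F q ⊆ R.boundary Q F :=
  Set.subset_biUnion_of_mem (u := fun q => R.leaving F q) hq

theorem boundary_subset (R : CellSpace M G) (Q : Set R.Coset) (F : Set M) :
    R.boundary Q F ⊆ F :=
  Set.iUnion₂_subset fun _ _ => Set.sdiff_subset

theorem ncard_boundary_le_sum (R : CellSpace M G) (Q : Finset R.Coset) (F : Set M) :
    (R.boundary (Q : Set R.Coset) F).ncard ≤ ∑ q ∈ Q, (R.leaving F q).ncard := by
  have := Finset.set_ncard_biUnion_le Q fun q => R.leaving F q
  simpa [boundary] using this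

/-- The step along `g • s` is a step along `g` followed by one along some `h • s ∈ S`. Either the
first leaves `F`, or it ends in the `S`-boundary, whose preimage grows by at most `|G₀|`. -/
theorem ncard_leaving_smul_le (R : CellSpace M G) [Finite R.stab] {S : Set R.Coset}
    (hS : ∀ g₀ ∈ R.stab, ∀ s ∈ S, g₀ • s ∈ S) (g : G) {s : R.Coset} (hs : s ∈ S) {F : Set M}
    (hF : F.Finite) :
    (R.leaving F (g • s)).ncard ≤
      (R.leaving F (g : R.Coset)).ncard + (R.boundary S F).ncard * Nat.card R.stab := by
  have hB : (R.boundary S F).Finite := hF.subset (R.boundary_subset S F)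
  have hsub : R.leaving F (g • s) ⊆
      R.leaving F (g : R.Coset) ∪ (fun m => R.semiAct m (g : R.Coset)) ⁻¹' R.boundary S F := by
    rintro m ⟨hm, hm'⟩
    obtain ⟨h, hh, H⟩ := R.exists_semiAct_smul m g
    by_cases hv : R.semiAct m (g : R.Coset) ∈ F
    · refine Or.inr (R.leaving_subset_boundary F (hS h hh s hs) ⟨hv, fun hv' => hm' ?_⟩)
      simpa only [Set.mem_preimage, H] using hv'
    · exact Or.inl ⟨hm, hv⟩
  calc _ ≤ _ := Set.ncard_le_ncard hsub
          ((hF.subset Set.sdiff_subset).union (R.finite_preimage_semiAct g hB))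
    _ ≤ _ := Set.ncard_union_le _ _
    _ ≤ _ := Nat.add_le_add_left (R.ncard_preimage_semiAct_le g hB) _

/-- Cosets correspond bijectively to points of `M`, so a word reaching the point of `q` describes
`q` itself. Each letter adds `|G₀|` to the constant, which does not depend on `F`. -/
theorem exists_ncard_leaving_le_of_word (R : CellSpace M G) [Finite R.stab] {S : Set R.Coset}
    (hS : ∀ g₀ ∈ R.stab, ∀ s ∈ S, g₀ • s ∈ S) (l : List R.Coset) :
    (∀ s ∈ l, s ∈ S) → ∀ q : R.Coset,
      MulAction.ofQuotientStabilizer G R.origin q = l.foldl R.semiAct R.origin →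
      ∃ C : ℕ, ∀ F : Set M, F.Finite →
        (R.leaving F q).ncard ≤ C * (R.boundary S F).ncard := by
  induction l using List.reverseRecOn with
  | nil =>
    intro _ q hq
    refine ⟨0, fun F _ => ?_⟩
    have hq1 : q = ((1 : G) : R.Coset) := by
      apply MulAction.injective_ofQuotientStabilizer G R.origin
      rw [hq, MulAction.ofQuotientStabilizer_mk, one_smul]
      rfl
    have : R.leaving F q = ∅ := by
      subst hq1
      simp only [leaving, semiAct_one]
      simp
    simp [this]
  | append_singleton l s ih =>
    intro hl q hq
    set v := l.foldl R.semiAct R.origin with hv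
    obtain ⟨C, hC⟩ := ih (fun t ht => hl t (by simp [ht])) (R.coord v : R.Coset)
      (by rw [MulAction.ofQuotientStabilizer_mk, R.coord_smul_origin])
    -- Both cosets name the end point `v ⊲ s` of the word.
    have hqs : q = R.coord v • s := by
      apply MulAction.injective_ofQuotientStabilizer G R.origin
      rw [hq, MulAction.ofQuotientStabilizer_smul, List.foldl_append]
      rfl
    refine ⟨C + Nat.card R.stab, fun F hF => ?_⟩
    rw [hqs, add_mul, mul_comm (Nat.card _)]
    exact (R.ncard_leaving_smul_le hS _ (hl s (by simp)) hF).trans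
      (Nat.add_le_add_right (hC F hF) _)

theorem exists_ncard_leaving_le (R : CellSpace M G) [Finite R.stab] {S : Set R.Coset}
    (hgen : R.IsRightGenerating S) (hsymm : R.IsSymmetric S) (q : R.Coset) :
    ∃ C : ℕ, ∀ F : Set M, F.Finite → (R.leaving F q).ncard ≤ C * (R.boundary S F).ncard := by
  obtain ⟨l, hl, h⟩ := hgen.exists_word (MulAction.ofQuotientStabilizer G R.origin q)
  exact R.exists_ncard_leaving_le_of_word hgen.stab_smul_mem l
    (fun s hs => (hl s hs).elim id fun h => hsymm h) q h.symm

theorem exists_ncard_boundary_le (R : CellSpace M G) [Finite R.stab] {S : Set R.Coset}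
    (hgen : R.IsRightGenerating S) (hsymm : R.IsSymmetric S) {Q : Set R.Coset} (hQ : Q.Finite) :
    ∃ C : ℕ, ∀ F : Set M, F.Finite →
      (R.boundary Q F).ncard ≤ C * (R.boundary S F).ncard := by
  choose C hC using R.exists_ncard_leaving_le hgen hsymm
  lift Q to Finset R.Coset using hQ
  refine ⟨∑ q ∈ Q, C q, fun F hF => (R.ncard_boundary_le_sum Q F).trans ?_⟩
  rw [Finset.sum_mul]
  exact Finset.sum_le_sum fun q _ => hC q F hF

/-! ### Almost invariance of counting measures -/

theorem ncard_inter_le_image (R : CellSpace M G) (q : R.Coset) {A : Set M}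
    (hA : Set.InjOn (fun m => R.semiAct m q) A) {F : Set M} (hF : F.Finite) :
    (A ∩ F).ncard ≤
      ((fun m => R.semiAct m q) '' A ∩ F).ncard + (R.leaving F q).ncard := by
  have hsub : A ∩ F ⊆ (A ∩ F ∩ (fun m => R.semiAct m q) ⁻¹' F) ∪ R.leaving F q := by
    intro m hm
    by_cases h : R.semiAct m q ∈ F
    · exact Or.inl ⟨hm, h⟩
    · exact Or.inr ⟨hm.2, h⟩
  have hfin : (A ∩ F ∩ (fun m => R.semiAct m q) ⁻¹' F).Finite :=
    hF.subset fun m hm => hm.1.2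
  refine (Set.ncard_le_ncard hsub (hfin.union (hF.subset Set.sdiff_subset))).trans
    ((Set.ncard_union_le _ _).trans (Nat.add_le_add_right ?_ _))
  rw [← Set.InjOn.ncard_image (hA.mono fun m hm => hm.1.1)]
  refine Set.ncard_le_ncard ?_ (hF.subset Set.inter_subset_right)
  rintro _ ⟨m, hm, rfl⟩
  exact ⟨⟨m, hm.1.1, rfl⟩, hm.2⟩

/-- A point of the image in `F` whose origin lies outside `F` leaves `F` along a reversing coset. -/
theorem ncard_image_inter_le (R : CellSpace M G) (g : G) (A : Set M) {F : Set M}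
    (hF : F.Finite) :
    ((fun m => R.semiAct m (g : R.Coset)) '' A ∩ F).ncard ≤
      (A ∩ F).ncard + (R.boundary (R.reverseCosets g) F).ncard := by
  have hsub : (fun m => R.semiAct m (g : R.Coset)) '' A ∩ F ⊆
      (fun m => R.semiAct m (g : R.Coset)) '' (A ∩ F) ∪ R.boundary (R.reverseCosets g) F := by
    rintro _ ⟨⟨m, hm, rfl⟩, hv⟩
    by_cases h : m ∈ F
    · exact Or.inl ⟨m, ⟨hm, h⟩, rfl⟩
    · obtain ⟨q, hq, hq'⟩ := R.exists_reverse m g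
      exact Or.inr (R.leaving_subset_boundary F hq ⟨hv, fun h' => h (by simpa [hq'] using h')⟩)
  have hAF : (A ∩ F).Finite := hF.subset Set.inter_subset_right
  exact (Set.ncard_le_ncard hsub ((hAF.image _).union (hF.subset (R.boundary_subset _ F)))).trans
    ((Set.ncard_union_le _ _).trans (Nat.add_le_add_right (Set.ncard_image_le hAF) _))

theorem exists_abs_ncard_image_inter_sub_le (R : CellSpace M G) [Finite R.stab]
    {S : Set R.Coset} (hgen : R.IsRightGenerating S) (hsymm : R.IsSymmetric S) (q : R.Coset) :
    ∃ C : ℝ, ∀ A : Set M, Set.InjOn (fun m => R.semiAct m q) A → ∀ F : Set M, F.Finite →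
      |(((fun m => R.semiAct m q) '' A ∩ F).ncard : ℝ) - ((A ∩ F).ncard : ℝ)| ≤
        C * ((R.boundary S F).ncard : ℝ) := by
  induction q using QuotientGroup.induction_on with
  | H g =>
    obtain ⟨C₁, h₁⟩ := R.exists_ncard_leaving_le hgen hsymm (g : R.Coset)
    obtain ⟨C₂, h₂⟩ := R.exists_ncard_boundary_le hgen hsymm (R.finite_reverseCosets g)
    refine ⟨C₁ + C₂, fun A hA F hF => ?_⟩
    have e₁ : ((A ∩ F).ncard : ℝ) ≤
        ((fun m => R.semiAct m (g : R.Coset)) '' A ∩ F).ncard + C₁ * (R.boundary S F).ncard := by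
      exact_mod_cast (R.ncard_inter_le_image _ hA hF).trans (Nat.add_le_add_left (h₁ F hF) _)
    have e₂ : (((fun m => R.semiAct m (g : R.Coset)) '' A ∩ F).ncard : ℝ) ≤
        (A ∩ F).ncard + C₂ * (R.boundary S F).ncard := by
      exact_mod_cast (R.ncard_image_inter_le g A hF).trans (Nat.add_le_add_left (h₂ F hF) _)
    have n₁ : (0 : ℝ) ≤ C₁ * (R.boundary S F).ncard := by positivity
    have n₂ : (0 : ℝ) ≤ C₂ * (R.boundary S F).ncard := by positivity
    rw [abs_le]
    constructor <;> linarith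

end CellSpace

/-! ### Finitely additive probability measures -/

open Filter Topology in
/-- The limit along an ultrafilter of the normalised counting measures of finite sets. -/
theorem exists_isFinAddProbMeasure_tendsto {M ι : Type*} (U : Ultrafilter ι) (F : ι → Finset M)
    (hF : ∀ i, (F i).Nonempty) :
    ∃ μ : Set M → ℝ, IsFinAddProbMeasure μ ∧ ∀ A : Set M,
      Tendsto (fun i => ((A ∩ (F i : Set M)).ncard : ℝ) / ((F i).card : ℝ)) U (𝓝 (μ A)) := by
  have hpos : ∀ i, (0 : ℝ) < (F i).card := fun i => by exact_mod_cast (hF i).card_pos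
  have hlim : ∀ A : Set M, ∃ x : ℝ, 0 ≤ x ∧
      Tendsto (fun i => ((A ∩ (F i : Set M)).ncard : ℝ) / ((F i).card : ℝ)) U (𝓝 x) := by
    intro A
    have hmem : ∀ i, ((A ∩ (F i : Set M)).ncard : ℝ) / ((F i).card : ℝ) ∈ Set.Icc (0 : ℝ) 1 := by
      intro i
      refine ⟨by positivity, (div_le_one (hpos i)).2 ?_⟩
      have := Set.ncard_le_ncard (Set.inter_subset_right (s := A)) (F i).finite_toSet
      rw [Set.ncard_coe_finset] at this
      exact_mod_cast this
    -- By compactness of `[0, 1]` the one ultrafilter yields a limit for every `A` simultaneously;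
    -- additivity passes to these limits.
    obtain ⟨x, hx, hle⟩ := (isCompact_Icc (a := (0 : ℝ)) (b := 1)).ultrafilter_le_nhds
      (U.map fun i => ((A ∩ (F i : Set M)).ncard : ℝ) / ((F i).card : ℝ))
      (le_principal_iff.2 (Ultrafilter.mem_map.2 (univ_mem' hmem)))
    exact ⟨x, hx.1, hle⟩
  choose μ hμ₀ hμ using hlim
  refine ⟨μ, ⟨hμ₀, ?_, fun A B hAB => ?_⟩, hμ⟩
  · refine tendsto_nhds_unique (hμ Set.univ) (tendsto_const_nhds.congr fun i => ?_)
    rw [Set.univ_inter, Set.ncard_coe_finset, div_self (hpos i).ne']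
  · refine tendsto_nhds_unique (hμ (A ∪ B)) (((hμ A).add (hμ B)).congr fun i => ?_)
    rw [← add_div, Set.union_inter_distrib_right, Set.ncard_union_eq
      (hAB.mono Set.inter_subset_left Set.inter_subset_left)
      ((F i).finite_toSet.subset Set.inter_subset_right)
      ((F i).finite_toSet.subset Set.inter_subset_right)]
    push_cast
    rfl

namespace IsFinAddProbMeasure

variable {M : Type*} {μ : Set M → ℝ}

theorem empty (hμ : IsFinAddProbMeasure μ) : μ ∅ = 0 := by
  have := hμ.union_eq_add ∅ ∅ (by simp)
  rw [Set.union_empty] at this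
  linarith

theorem le_one (hμ : IsFinAddProbMeasure μ) (A : Set M) : μ A ≤ 1 := by
  have := hμ.union_eq_add A Aᶜ disjoint_compl_right
  rw [Set.union_compl_self, hμ.univ_eq_one] at this
  linarith [hμ.nonneg Aᶜ]

theorem biUnion_finset {ι : Type*} (hμ : IsFinAddProbMeasure μ) (s : Finset ι) (A : ι → Set M)
    (hA : (s : Set ι).PairwiseDisjoint A) : μ (⋃ i ∈ s, A i) = ∑ i ∈ s, μ (A i) := by
  classical
  induction s using Finset.induction_on with
  | empty => simp [hμ.empty]
  | insert a s ha ih =>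
    rw [Finset.set_biUnion_insert, Finset.sum_insert ha, hμ.union_eq_add, ih]
    · exact hA.subset (by simp)
    · rw [Set.disjoint_iUnion₂_right]
      intro i hi
      exact hA (by simp) (by simp [hi]) (by rintro rfl; exact ha hi)

end IsFinAddProbMeasure

/-! ### Amenability from small boundaries, and the obstruction to doubling -/

namespace CellSpace

variable {M : Type*} {G : Type*} [Group G] [MulAction G M]

open Filter Topology in
theorem rightAmenable_of_exists_boundary_le (R : CellSpace M G) [Finite R.stab]
    {S : Set R.Coset} (hgen : R.IsRightGenerating S) (hsymm : R.IsSymmetric S)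
    (h : ∀ ε : ℝ, 0 < ε → ∃ F : Finset M, F.Nonempty ∧
      ((R.boundary S (F : Set M)).ncard : ℝ) / (F.card : ℝ) < ε) :
    R.RightAmenable := by
  choose F hF hFb using fun n : ℕ => h (1 / ((n : ℝ) + 1)) Nat.one_div_pos_of_nat
  have hb : Tendsto (fun n => ((R.boundary S (F n : Set M)).ncard : ℝ) / ((F n).card : ℝ))
      (hyperfilter ℕ) (𝓝 0) :=
    -- The hyperfilter refines `atTop`, so ordinary limits persist along it.
    (squeeze_zero (fun n => by positivity) (fun n => (hFb n).le)
      tendsto_one_div_add_atTop_nhds_zero_nat).mono_left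
        (by rw [← Nat.cofinite_eq_atTop]; exact hyperfilter_le_cofinite)
  obtain ⟨μ, hμ, hlim⟩ := exists_isFinAddProbMeasure_tendsto (hyperfilter ℕ) F hF
  refine ⟨μ, hμ, fun q A hA => ?_⟩
  obtain ⟨C, hC⟩ := R.exists_abs_ncard_image_inter_sub_le hgen hsymm q
  have h0 := squeeze_zero_norm (fun n => ?_) (by simpa using hb.const_mul C)
    (f := fun n => (((fun m => R.semiAct m q) '' A ∩ (F n : Set M)).ncard : ℝ) / (F n).card -
      ((A ∩ (F n : Set M)).ncard : ℝ) / (F n).card)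
  · exact sub_eq_zero.1 (tendsto_nhds_unique ((hlim _).sub (hlim A)) h0)
  · rw [← sub_div, Real.norm_eq_abs, abs_div, Nat.abs_cast, ← mul_div_assoc]
    exact div_le_div_of_nonneg_right (hC A hA _ (F n).finite_toSet) (Nat.cast_nonneg _)

/-- A semi-invariant measure excludes that two copies of `M` are moved injectively into `M` by
finitely many steps. -/
theorem RightAmenable.not_injective {R : CellSpace M G} (hR : R.RightAmenable)
    (Q : Finset R.Coset) (c : M × Bool → R.Coset) (hc : ∀ x, c x ∈ Q) :
    ¬ Function.Injective fun x : M × Bool => R.semiAct x.1 (c x) := by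
  intro hinj
  obtain ⟨μ, hμ, hinv⟩ := hR
  -- For each copy `b`, the sets `A (q, b)` partition `M` according to the coset used; the injection
  -- is the step along `q` on each piece, and all images are disjoint.
  let A : R.Coset × Bool → Set M := fun p => {m | c (m, p.2) = p.1}
  have hAinj : ∀ p, Set.InjOn (fun m => R.semiAct m p.1) (A p) := by
    intro p m hm m' hm' h
    have := @hinj (m, p.2) (m', p.2) (by
      simp only [A, Set.mem_ofPred_eq] at hm hm'
      simpa only [hm, hm'] using h)
    exact congrArg Prod.fst this
  have hone : ∀ b, ∑ q ∈ Q, μ (A (q, b)) = 1 := by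
    intro b
    rw [← hμ.biUnion_finset Q fun q => A (q, b), ← hμ.univ_eq_one]
    · congr 1
      ext m
      simp [A, hc]
    · intro q _ q' _ hne
      exact Set.disjoint_left.2 fun m hm hm' => hne (hm.symm.trans hm')
  have hdisj : ((Q ×ˢ (Finset.univ : Finset Bool) : Finset (R.Coset × Bool)) :
      Set (R.Coset × Bool)).PairwiseDisjoint
        fun p => (fun m => R.semiAct m p.1) '' A p := by
    intro p _ p' _ hne
    refine Set.disjoint_left.2 ?_
    rintro _ ⟨m, hm, rfl⟩ ⟨m', hm', h⟩
    simp only [A, Set.mem_ofPred_eq] at hm hm'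
    have := @hinj (m', p'.2) (m, p.2) (by simpa only [hm, hm'] using h)
    obtain ⟨rfl, hb⟩ := Prod.mk.inj this
    refine hne (Prod.ext ?_ hb.symm)
    rw [← hm, ← hm', hb]
  have hle := hμ.le_one (⋃ p ∈ Q ×ˢ (Finset.univ : Finset Bool),
    (fun m => R.semiAct m p.1) '' A p)
  rw [hμ.biUnion_finset _ _ hdisj, Finset.sum_congr rfl fun p _ => hinv p.1 (A p) (hAinj p),
    Finset.sum_product_right, Finset.sum_congr rfl fun b _ => hone b] at hle
  norm_num at hle

/-! ### Expansion, doubling and Hall's theorem -/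

theorem ncard_add_ncard_leaving_div_le (R : CellSpace M G) [Finite R.stab] {S : Set R.Coset}
    (hS : S.Finite) {s : R.Coset} (hs : s ∈ S) {F : Set M} (hF : F.Finite) :
    (F.ncard : ℝ) + ((R.leaving F s).ncard : ℝ) / (Nat.card R.stab : ℝ) ≤
      ((Set.image2 R.semiAct F (insert ((1 : G) : R.Coset) S)).ncard : ℝ) := by
  set N := Set.image2 R.semiAct F (insert ((1 : G) : R.Coset) S) with hN
  have hNfin : N.Finite := hF.image2 _ (hS.insert _)
  have hFN : F ⊆ N := fun m hm => ⟨m, hm, _, Set.mem_insert _ _, R.semiAct_one m⟩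
  -- Points leaving along `s` land in `N \ F`, at most `|G₀|` of them on each point.
  have hle : (R.leaving F s).ncard ≤ (N \ F).ncard * Nat.card R.stab := by
    obtain ⟨g, rfl⟩ := QuotientGroup.mk_surjective s
    refine (Set.ncard_le_ncard ?_ (R.finite_preimage_semiAct g hNfin.sdiff)).trans
      (R.ncard_preimage_semiAct_le g hNfin.sdiff)
    rintro m ⟨hm, hm'⟩
    exact ⟨⟨m, hm, _, Set.mem_insert_of_mem _ hs, rfl⟩, hm'⟩
  have hcard : (0 : ℝ) < Nat.card R.stab := by exact_mod_cast Nat.card_pos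
  have hsum : ((N \ F).ncard : ℝ) + F.ncard = N.ncard := by
    exact_mod_cast Set.ncard_sdiff_add_ncard_of_subset hFN hNfin
  have : ((R.leaving F s).ncard : ℝ) / (Nat.card R.stab : ℝ) ≤ (N \ F).ncard := by
    rw [div_le_iff₀ hcard]
    exact_mod_cast hle
  linarith

/-- Iterating an expansion by one step. -/
theorem exists_finite_pow_mul_ncard_le (R : CellSpace M G) {T : Set R.Coset}
    (hT : T.Finite) (hT' : ∀ g₀ ∈ R.stab, ∀ t ∈ T, g₀ • t ∈ T) {a : ℝ} (ha : 0 ≤ a)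
    (hexp : ∀ F : Set M, F.Finite → a * F.ncard ≤ (Set.image2 R.semiAct F T).ncard) (n : ℕ) :
    ∃ Q : Set R.Coset, Q.Finite ∧ ∀ F : Set M, F.Finite →
      a ^ n * F.ncard ≤ (Set.image2 R.semiAct F Q).ncard := by
  induction n with
  | zero =>
    refine ⟨{((1 : G) : R.Coset)}, Set.finite_singleton _, fun F _ => ?_⟩
    simp [R.semiAct_one]
  | succ n ih =>
    obtain ⟨Q, hQ, h⟩ := ih
    -- The twist from composing two steps is absorbed by the `G₀`-stability of `T`, so one finite
    -- set of cosets serves all starting points.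
    refine ⟨Set.image2 (fun (q : R.Coset) t => q.out • t) Q T, hQ.image2 _ hT,
      fun F hF => ?_⟩
    have hsub : Set.image2 R.semiAct (Set.image2 R.semiAct F Q) T ⊆
        Set.image2 R.semiAct F (Set.image2 (fun (q : R.Coset) t => q.out • t) Q T) := by
      rintro _ ⟨_, ⟨m, hm, q, hq, rfl⟩, t, ht, rfl⟩
      obtain ⟨h, hh, H⟩ := R.exists_semiAct_semiAct m q.out t
      rw [QuotientGroup.out_eq'] at H
      exact ⟨m, hm, _, ⟨q, hq, h • t, hT' h hh t ht, rfl⟩, H.symm⟩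
    calc a ^ (n + 1) * F.ncard = a * (a ^ n * F.ncard) := by ring
      _ ≤ a * (Set.image2 R.semiAct F Q).ncard := mul_le_mul_of_nonneg_left (h F hF) ha
      _ ≤ _ := hexp _ (hF.image2 _ hQ)
      _ ≤ _ := by
        exact_mod_cast Set.ncard_le_ncard hsub (hF.image2 _ (hQ.image2 _ hT))

/-- Hall's condition for `M × Bool`: a finite set there has at most twice as many elements as its
projection to `M`, which the hypothesis doubles. -/
theorem exists_injective_of_two_mul_ncard_le (R : CellSpace M G) (Q : Finset R.Coset)
    (hQ : ∀ F : Set M, F.Finite → 2 * F.ncard ≤ (Set.image2 R.semiAct F (Q : Set R.Coset)).ncard) :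
    ∃ c : M × Bool → R.Coset, (∀ x, c x ∈ Q) ∧
      Function.Injective fun x : M × Bool => R.semiAct x.1 (c x) := by
  classical
  obtain ⟨f, hf, hfQ⟩ := (Finset.all_card_le_biUnion_card_iff_exists_injective
    fun x : M × Bool => Q.image (R.semiAct x.1)).1 (by
      intro s
      have h₁ : s.card ≤ (s.image Prod.fst).card * 2 := by
        rw [← Fintype.card_bool, ← Finset.card_univ, ← Finset.card_product]
        exact Finset.card_le_card fun x hx =>
          Finset.mem_product.2 ⟨Finset.mem_image_of_mem _ hx, Finset.mem_univ _⟩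
      have h₂ := hQ (s.image Prod.fst : Finset M) (Finset.finite_toSet _)
      rw [← Finset.coe_image₂, Set.ncard_coe_finset, Set.ncard_coe_finset, mul_comm] at h₂
      refine h₁.trans (h₂.trans (Finset.card_le_card ?_))
      intro v hv
      obtain ⟨m, hm, q, hq, rfl⟩ := Finset.mem_image₂.1 hv
      obtain ⟨x, hx, rfl⟩ := Finset.mem_image.1 hm
      exact Finset.mem_biUnion.2 ⟨x, hx, Finset.mem_image_of_mem _ hq⟩)
  choose c hc hcf using fun x => Finset.mem_image.1 (hfQ x)
  exact ⟨c, hc, by simpa only [hcf] using hf⟩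

theorem RightAmenable.exists_leaving_lt {R : CellSpace M G} [Finite R.stab]
    (hR : R.RightAmenable) {S : Set R.Coset} (hfin : S.Finite)
    (hS : ∀ g₀ ∈ R.stab, ∀ s ∈ S, g₀ • s ∈ S) {ε : ℝ} (hε : 0 < ε) :
    ∃ F : Finset M, F.Nonempty ∧
      ∀ s ∈ S, ((R.leaving (F : Set M) s).ncard : ℝ) / (F.card : ℝ) < ε := by
  by_contra! hcon
  have hcard : (0 : ℝ) < Nat.card R.stab := by exact_mod_cast Nat.card_pos
  -- At least `ε |F|` points leave along some `s`, and these land on at least `ε |F| / |G₀|` new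
  -- points.
  set δ : ℝ := ε / Nat.card R.stab with hδ
  have hδ0 : 0 < δ := div_pos hε hcard
  have hexp : ∀ F : Set M, F.Finite →
      (1 + δ) * F.ncard ≤ (Set.image2 R.semiAct F (insert ((1 : G) : R.Coset) S)).ncard := by
    intro F hF
    lift F to Finset M using hF
    rcases F.eq_empty_or_nonempty with rfl | hne
    · simp
    obtain ⟨s, hs, hle⟩ := hcon F hne
    have hFpos : (0 : ℝ) < F.card := by exact_mod_cast hne.card_pos
    rw [le_div_iff₀ hFpos] at hle
    refine le_trans ?_ (R.ncard_add_ncard_leaving_div_le hfin hs F.finite_toSet)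
    rw [Set.ncard_coe_finset, add_mul, one_mul, hδ, div_mul_eq_mul_div]
    gcongr
  obtain ⟨n, hn⟩ := pow_unbounded_of_one_lt 2 (by linarith : 1 < 1 + δ)
  obtain ⟨Q, hQ, h⟩ := R.exists_finite_pow_mul_ncard_le (hfin.insert _) (by
    rintro g₀ hg₀ t (rfl | ht)
    · exact Or.inl (R.smul_one_coset hg₀)
    · exact Or.inr (hS g₀ hg₀ t ht)) (by positivity) hexp n
  lift Q to Finset R.Coset using hQ
  obtain ⟨c, hc, hinj⟩ := R.exists_injective_of_two_mul_ncard_le Q fun F hF => by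
    have : (2 : ℝ) * F.ncard ≤ (Set.image2 R.semiAct F (Q : Set R.Coset)).ncard :=
      (mul_le_mul_of_nonneg_right hn.le (Nat.cast_nonneg _)).trans (h F hF)
    exact_mod_cast this
  exact hR.not_injective Q c hc hinj

/-! ### The isoperimetric constant and the union bound -/

theorem isoperimetricConstant_eq_zero_iff (R : CellSpace M G) (S : Set R.Coset) :
    R.isoperimetricConstant S = 0 ↔ ∀ ε : ℝ, 0 < ε → ∃ F : Finset M, F.Nonempty ∧
      ((R.boundary S (F : Set M)).ncard : ℝ) / (F.card : ℝ) < ε := by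
  have : Nonempty {F : Finset M // F.Nonempty} := ⟨⟨{R.origin}, Finset.singleton_nonempty _⟩⟩
  have hbdd : BddBelow (Set.range fun F : {F : Finset M // F.Nonempty} =>
      ((⋃ e ∈ S, R.leaving (F.1 : Set M) e).ncard : ℝ) / (F.1.card : ℝ)) :=
    ⟨0, by rintro _ ⟨F, rfl⟩; positivity⟩
  constructor
  · intro h ε hε
    obtain ⟨F, hF⟩ := exists_lt_of_ciInf_lt (lt_of_eq_of_lt h hε)
    exact ⟨F.1, F.2, hF⟩
  · intro h
    refine le_antisymm (le_of_forall_pos_le_add fun ε hε => ?_)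
      (Real.iInf_nonneg fun F => by positivity)
    obtain ⟨F, hF, hlt⟩ := h ε hε
    rw [zero_add]
    exact (ciInf_le hbdd ⟨F, hF⟩).trans hlt.le

theorem exists_boundary_lt_iff (R : CellSpace M G) {S : Set R.Coset} (hfin : S.Finite) :
    (∀ ε : ℝ, 0 < ε → ∃ F : Finset M, F.Nonempty ∧
      ((R.boundary S (F : Set M)).ncard : ℝ) / (F.card : ℝ) < ε) ↔
    ∀ ε : ℝ, 0 < ε → ∃ F : Finset M, F.Nonempty ∧
      ∀ s ∈ S, ((R.leaving (F : Set M) s).ncard : ℝ) / (F.card : ℝ) < ε := by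
  constructor
  · intro h ε hε
    obtain ⟨F, hF, hlt⟩ := h ε hε
    refine ⟨F, hF, fun s hs => lt_of_le_of_lt ?_ hlt⟩
    gcongr
    · exact F.finite_toSet.subset (R.boundary_subset S _)
    · exact R.leaving_subset_boundary _ hs
  · intro h ε hε
    lift S to Finset R.Coset using hfin
    -- The `+ 1` covers empty `S` and makes the summed bound strict.
    obtain ⟨F, hF, hlt⟩ := h (ε / (S.card + 1)) (by positivity)
    refine ⟨F, hF, ?_⟩
    calc ((R.boundary (S : Set R.Coset) (F : Set M)).ncard : ℝ) / (F.card : ℝ)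
        ≤ (∑ s ∈ S, ((R.leaving (F : Set M) s).ncard : ℝ)) / (F.card : ℝ) := by
          gcongr
          exact_mod_cast R.ncard_boundary_le_sum S F
      _ = ∑ s ∈ S, ((R.leaving (F : Set M) s).ncard : ℝ) / (F.card : ℝ) := Finset.sum_div _ _ _
      _ ≤ ∑ _s ∈ S, ε / (S.card + 1) := Finset.sum_le_sum fun s hs => (hlt s hs).le
      _ = S.card * (ε / (S.card + 1)) := by rw [Finset.sum_const, nsmul_eq_mul]
      _ < ε := by
        rw [← mul_div_assoc, div_lt_iff₀ (by positivity)]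
        nlinarith

end CellSpace

theorem mainTheorem2 {M : Type*} {G : Type*} [Group G] [MulAction G M] (R : CellSpace M G)
    (hG₀ : Finite R.stab) (S : Set R.Coset) (hfin : S.Finite)
    (hgen : R.IsRightGenerating S) (hsymm : R.IsSymmetric S) :
    List.TFAE [
      R.RightAmenable,
      ∀ ε : ℝ, 0 < ε → ∃ F : Finset M, F.Nonempty ∧
        ∀ s ∈ S, ((R.leaving (F : Set M) s).ncard : ℝ) / (F.card : ℝ) < ε,
      R.isoperimetricConstant S = 0] := by
  tfae_have 1 → 2 := fun h _ hε => h.exists_leaving_lt hfin hgen.stab_smul_mem hε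
  tfae_have 2 ↔ 3 :=
    (R.exists_boundary_lt_iff hfin).symm.trans (R.isoperimetricConstant_eq_zero_iff S).symm
  tfae_have 3 → 1 := fun h => R.rightAmenable_of_exists_boundary_le hgen hsymm
    ((R.isoperimetricConstant_eq_zero_iff S).1 h)
  tfae_finish
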